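/- Let $\alpha\in(0,1)$, $a>0$, $b\ge 0$, $c>0$ and $0<\beta<1$. Let $\mathcal{GLK}(a,b,c,\beta)$ denote the distribution on $\mathbb{N}=\{0,1,2,\dots\}$ with probability mass function $$p_x=\frac{1}{x!}\,\beta^{x}\,\frac{a}{c}\,\frac{1}{\frac ac+x\frac bc+x}\,(1-\beta)^{\frac ac+x\frac bc}\Big(\frac ac+x\frac bc+1\Big)_{x\uparrow},\qquad x\in\mathbb{N},$$ where $(y)_{k\uparrow}=y(y+1)\cdots(y+k-1)$ and $(y)_{0\uparrow}=1$. A GLK-INAR(1) process is an $\mathbb{N}$-valued process $\{X_t\}_{t\in\mathbb{Z}}$ satisfying almost surely, for all $t\in\mathbb{Z}$, $$X_t=\alpha\circ X_{t-1}+\varepsilon_t,\qquad \alpha\circ X_{t-1}=\sum_{i=1}^{X_{t-1}}B_{t,i},$$ where the $\varepsilon_t$ are i.i.d. with law $\mathcal{GLK}(a,b,c,\beta)$, for each $t$ the $B_{t,i}$, $i\ge1$, are i.i.d. Bernoulli($\alpha$), and for each $t$ the past $(X_s)_{s\le t-1}$, the innovation $\varepsilon_t$ and the sequence $(B_{t,i})_{i\ge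 1}$ are mutually independent. It is associated with the transition probabilities on $\mathbb{N}$ $$P_{i,j}=\sum_{k=0}^{\min(i,j)}\binom ik\alpha^k(1-\alpha)^{i-k}p_{j-k}.$$ A probability distribution on $\mathbb{N}$ is called infinitely divisible if for every $n\ge1$ it is the law of a sum of $n$ i.i.d. $\mathbb{N}$-valued random variables. Then every stationary distribution of the GLK-INAR(1) process is infinitely divisible. That is: (i) every probability distribution $(\pi_j)_{j\in\mathbb{N}}$ with $\pi_j=\sum_{i\ge0}P_{i,j}\pi_i$ for all $j\in\mathbb{N}$ is infinitely divisible; (ii) for every strictly stationary GLK-INAR(1) process $\{X_t\}_{t\in\mathbb{Z}}$ and every $t\in\mathbb{Z}$, the law of $X_t$ is infinitely divisible. (If the weights $p_x$ do not sum to $1$, there is no such process and no such $\pi$, and the statement is void.) -/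

import Mathlib

open MeasureTheory ProbabilityTheory

noncomputable section

/-- The probability mass function of the generalized Lagrangian Katz distribution
`GLK(a, b, c, β)`; the last factor is the rising factorial `(a/c + x b/c + 1)_{x ↑}`. -/
def glkPMF (a b c β : ℝ) (x : ℕ) : ℝ :=
  (1 / (x.factorial : ℝ)) * β ^ x * (a / c) * (1 / (a / c + x * (b / c) + x)) *
    (1 - β) ^ (a / c + x * (b / c)) *
    (ascPochhammer ℝ x).eval (a / c + x * (b / c) + 1)

/-- The transition probability from `i` to `j` of the GLK-INAR(1) chain. -/
def glkTransition (α a b c β : ℝ) (i j : ℕ) : ℝ :=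
  ∑ k ∈ Finset.range (min i j + 1),
    (i.choose k : ℝ) * α ^ k * (1 - α) ^ (i - k) * glkPMF a b c β (j - k)

/-- `π` is a stationary distribution of the GLK-INAR(1) chain: it is a probability measure on
`ℕ` with `π {j} = ∑ i, P i j * π {i}` for all `j`. -/
structure IsGLKStationaryDistribution (α a b c β : ℝ) (π : Measure ℕ) : Prop where
  isProbabilityMeasure : IsProbabilityMeasure π
  balance : ∀ j : ℕ,
    HasSum (fun i : ℕ => glkTransition α a b c β i j * π.real {i}) (π.real {j})

/-- The binomial thinning `∑_{i = 1}^{x} B_i`, with counting sequence `B`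
(indexed from `0` here). -/
def thinning (B : ℕ → ℕ) (x : ℕ) : ℕ := ∑ i ∈ Finset.range x, B i

/-- `X` is a GLK-INAR(1) process with innovations `ε`, in which `B t` is the counting sequence
of the thinning performed at time `t`.
At each time `t`, the variables `B t i` are independent Bernoulli(`α`), and the past
`(X s)_{s < t}`, the innovation `ε t` and the sequence `B t` are mutually independent. -/
structure IsGLKINAR {Ω : Type*} [MeasurableSpace Ω] (μ : Measure Ω) (α a b c β : ℝ)
    (X : ℤ → Ω → ℕ) (ε : ℤ → Ω → ℕ) (B : ℤ → ℕ → Ω → ℕ) : Prop where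
  measurable_X : ∀ t, Measurable (X t)
  measurable_ε : ∀ t, Measurable (ε t)
  measurable_B : ∀ t i, Measurable (B t i)
  law_ε : ∀ t x, μ.real {ω | ε t ω = x} = glkPMF a b c β x
  indep_ε : iIndepFun ε μ
  law_B_one : ∀ t i, μ.real {ω | B t i ω = 1} = α
  law_B_zero : ∀ t i, μ.real {ω | B t i ω = 0} = 1 - α
  indep_B : ∀ t, iIndepFun (B t) μ
  indep_ε_B : ∀ t, IndepFun (ε t) (fun ω i => B t i ω) μ
  indep_past : ∀ t,
    IndepFun (fun ω (s : Set.Iio t) => X s ω) (fun ω => (ε t ω, fun i => B t i ω)) μ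
  recursion : ∀ t, ∀ᵐ ω ∂μ, X t ω = thinning (fun i => B t i ω) (X (t - 1) ω) + ε t ω

/-- Strict stationarity of a process indexed by `ℤ`: its law on path space is shift invariant. -/
def IsStrictlyStationary {Ω : Type*} [MeasurableSpace Ω] (μ : Measure Ω)
    (X : ℤ → Ω → ℕ) : Prop :=
  ∀ h : ℤ, IdentDistrib (fun ω (t : ℤ) => X (t + h) ω) (fun ω (t : ℤ) => X t ω) μ μ

/-- Infinite divisibility of a distribution `ρ` on `ℕ`: for every `n ≥ 1`, `ρ` is the law of
the sum of `n` independent `ℕ`-valued random variables with a common law `ν`. -/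
def IsInfinitelyDivisible (ρ : Measure ℕ) : Prop :=
  ∀ n : ℕ, 1 ≤ n → ∃ ν : Measure ℕ, IsProbabilityMeasure ν ∧
    (Measure.pi (fun _ : Fin n => ν)).map (fun y => ∑ i, y i) = ρ

end

open scoped ENNReal Topology
open Filter

/-! Let `G` be the generating series of a stationary law and `H` that of the innovations.
Stationarity reads `G = T G * H`, where `T` substitutes `1 - α + α s` for `s`; `T` is multiplicative
and preserves total mass. The Hagen–Rothe identity makes the GLK weights a convolution semigroup in
`a`, so `H = q ^ n` with `q` the series of parameter `a / n`.

Iterating gives `G = (∏_{k < m} T^k q) ^ n * T^m G`. The remainder `T^m G` has mass `1` and constant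
coefficient `G(1 - α ^ m) → G(1) = 1`, so it tends to `1` coefficientwise. Compactness of `[0, ∞]^ℕ`
then yields a limit point `g` of the products, and `g ^ n = G`; its coefficients are the weights of
the required `n`-th convolution root.

Coefficients in `[0, ∞]` make every rearrangement of sums free. The marginal of a stationary process
satisfies the same equation for `G`, so both claims follow from one argument. -/

/-! ### Hagen–Rothe polynomials and their convolution -/

/-- The Hagen–Rothe polynomials `x / (x + k (r + 1)) * choose (x + k (r + 1)) k`, with the
denominator cancelled. -/
noncomputable def hagenRothe (r : ℝ) : ℕ → Polynomial ℝ
  | 0 => 1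
  | k + 1 => Polynomial.C (1 / ((k + 1).factorial : ℝ)) * Polynomial.X *
      (ascPochhammer ℝ k).comp (Polynomial.X + Polynomial.C (r * (k + 1) + 1))

theorem hagenRothe_eval_zero (r x : ℝ) : (hagenRothe r 0).eval x = 1 := by
  simp [hagenRothe]

theorem hagenRothe_eval_succ (r x : ℝ) (k : ℕ) :
    (hagenRothe r (k + 1)).eval x =
      1 / ((k + 1).factorial : ℝ) * x * (ascPochhammer ℝ k).eval (x + (r * (k + 1) + 1)) := by
  simp [hagenRothe]

theorem ascPochhammer_eval_succ_left (k : ℕ) (y : ℝ) :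
    (ascPochhammer ℝ (k + 1)).eval y = y * (ascPochhammer ℝ k).eval (y + 1) := by
  simp [ascPochhammer_succ_left]

/-- The two rising factorials on the left share all but one factor. In degree `k + 2` the remaining
factors combine to `(k + 2) * (x + r + 1)`, which lowers the factorial by one step. -/
theorem hagenRothe_difference (r x : ℝ) (k : ℕ) :
    (hagenRothe r (k + 1)).eval (x + 1) - (hagenRothe r (k + 1)).eval x =
      (hagenRothe r k).eval (x + (r + 1)) := by
  cases k with
  | zero => simp [hagenRothe]
  | succ k =>
    rw [hagenRothe_eval_succ, hagenRothe_eval_succ, hagenRothe_eval_succ,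
      ascPochhammer_succ_eval,
      ascPochhammer_eval_succ_left k (x + (r * ((k + 1 : ℕ) + 1) + 1))]
    have e₁ : x + 1 + (r * ((k + 1 : ℕ) + 1) + 1) = x + (r * (k + 2) + 1) + 1 := by
      push_cast; ring
    have e₂ : x + (r * ((k + 1 : ℕ) + 1) + 1) = x + (r * (k + 2) + 1) := by
      push_cast; ring
    have e₃ : x + (r + 1) + (r * (k + 1) + 1) = x + (r * (k + 2) + 1) + 1 := by ring
    rw [e₁, e₂, e₃, Nat.factorial_succ (k + 1)]
    have : ((k + 1).factorial : ℝ) ≠ 0 := by positivity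
    push_cast
    field_simp
    ring

theorem hagenRothe_eval_nonneg {r x : ℝ} (hr : 0 ≤ r) (hx : 0 ≤ x) (k : ℕ) :
    0 ≤ (hagenRothe r k).eval x := by
  cases k with
  | zero => simp [hagenRothe]
  | succ k =>
    rw [hagenRothe_eval_succ]
    have := ascPochhammer_pos k (x + (r * (k + 1) + 1)) (by positivity)
    positivity

theorem Polynomial.eval_eq_eval_zero_of_periodic {p : Polynomial ℝ}
    (h : ∀ x, p.eval (x + 1) = p.eval x) (x : ℝ) : p.eval x = p.eval 0 := by
  have hn : ∀ n : ℕ, p.eval (n : ℝ) = p.eval 0 := by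
    intro n
    induction n with
    | zero => simp
    | succ n ih => rw [Nat.cast_succ, h, ih]
  have : p = Polynomial.C (p.eval 0) := by
    apply Polynomial.eq_of_infinite_eval_eq
    refine (Set.infinite_range_of_injective (Nat.cast_injective (R := ℝ))).mono ?_
    rintro _ ⟨n, rfl⟩
    simp [hn n]
  rw [this]
  simp

/-- The Hagen–Rothe convolution identity. -/
theorem hagenRothe_convolution (r : ℝ) (n : ℕ) (x y : ℝ) :
    ∑ p ∈ Finset.HasAntidiagonal.antidiagonal n, (hagenRothe r p.1).eval x * (hagenRothe r p.2).eval y =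
      (hagenRothe r n).eval (x + y) := by
  induction n generalizing x with
  | zero => simp [hagenRothe]
  | succ n ih =>
    -- The defect of the identity, as a polynomial in `x`. Its unit difference vanishes by the
    -- induction hypothesis at `x + (r + 1)`, so it is constant; at `0` only the term of index `0`
    -- in the first factor survives, and the defect is zero.
    let F : Polynomial ℝ :=
      ∑ p ∈ Finset.HasAntidiagonal.antidiagonal (n + 1),
          hagenRothe r p.1 * Polynomial.C ((hagenRothe r p.2).eval y) -
        (hagenRothe r (n + 1)).comp (Polynomial.X + Polynomial.C y)
    have hF : ∀ z, F.eval z = ∑ p ∈ Finset.HasAntidiagonal.antidiagonal (n + 1),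
        (hagenRothe r p.1).eval z * (hagenRothe r p.2).eval y -
          (hagenRothe r (n + 1)).eval (z + y) := by
      intro z
      simp [F, Polynomial.eval_finsetSum]
    have hper : ∀ z, F.eval (z + 1) = F.eval z := by
      intro z
      rw [← sub_eq_zero, hF, hF, Finset.Nat.sum_antidiagonal_succ,
        Finset.Nat.sum_antidiagonal_succ]
      have h₁ := ih (z + (r + 1))
      have h₂ := hagenRothe_difference r (z + y) n
      rw [show z + y + (r + 1) = z + (r + 1) + y by ring] at h₂
      simp_rw [← hagenRothe_difference r z, sub_mul, Finset.sum_sub_distrib] at h₁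
      rw [show z + 1 + y = z + y + 1 by ring]
      simp only [hagenRothe_eval_zero]
      linarith
    have h0 := Polynomial.eval_eq_eval_zero_of_periodic hper x
    rw [hF, hF, Finset.Nat.sum_antidiagonal_succ (n := n) (f := fun p =>
      (hagenRothe r p.1).eval 0 * (hagenRothe r p.2).eval y)] at h0
    have hz : ∀ k, (hagenRothe r (k + 1)).eval 0 = 0 := fun k => by simp [hagenRothe_eval_succ]
    simp only [hagenRothe_eval_zero, hz, zero_mul, zero_add, Finset.sum_const_zero, one_mul,
      add_zero, sub_self] at h0
    linarith

/-! ### The GLK weights as a convolution semigroup in `a` -/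

/-- The last factor of the rising factorial cancels the denominator. The exponents that remain are
additive in the pair `(a, x)`, so only the Hagen–Rothe factor matters for convolution. -/
theorem glkPMF_eq_hagenRothe {a b c : ℝ} (β : ℝ) (ha : 0 < a) (hb : 0 ≤ b) (hc : 0 < c)
    (x : ℕ) :
    glkPMF a b c β x =
      β ^ x * (1 - β) ^ (a / c + x * (b / c)) * (hagenRothe (b / c) x).eval (a / c) := by
  have hθ : 0 < a / c := div_pos ha hc
  have hr : 0 ≤ b / c := div_nonneg hb hc.le
  unfold glkPMF
  generalize a / c = θ at *
  generalize b / c = r at *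
  cases x with
  | zero => simp [hagenRothe_eval_zero, hθ.ne']
  | succ k =>
    rw [hagenRothe_eval_succ, ascPochhammer_succ_eval,
      show θ + (r * (k + 1) + 1) = θ + ((k + 1 : ℕ) : ℝ) * r + 1 by push_cast; ring]
    have h : θ + ((k + 1 : ℕ) : ℝ) * r + ((k + 1 : ℕ) : ℝ) ≠ 0 := by positivity
    rw [show θ + ((k + 1 : ℕ) : ℝ) * r + 1 + (k : ℝ)
      = θ + ((k + 1 : ℕ) : ℝ) * r + ((k + 1 : ℕ) : ℝ) by push_cast; ring]
    field_simp

theorem glkPMF_nonneg {a b c β : ℝ} (ha : 0 < a) (hb : 0 ≤ b) (hc : 0 < c)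
    (hβ₀ : 0 < β) (hβ₁ : β < 1) (x : ℕ) : 0 ≤ glkPMF a b c β x := by
  rw [glkPMF_eq_hagenRothe β ha hb hc]
  have := hagenRothe_eval_nonneg (div_nonneg hb hc.le) (div_pos ha hc).le x
  have := Real.rpow_nonneg (sub_nonneg.2 hβ₁.le) (a / c + x * (b / c))
  positivity

theorem glkPMF_convolution {a a' b c β : ℝ} (ha : 0 < a) (ha' : 0 < a') (hb : 0 ≤ b)
    (hc : 0 < c) (hβ₁ : β < 1) (n : ℕ) :
    ∑ p ∈ Finset.HasAntidiagonal.antidiagonal n, glkPMF a b c β p.1 * glkPMF a' b c β p.2 =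
      glkPMF (a + a') b c β n := by
  rw [glkPMF_eq_hagenRothe β (add_pos ha ha') hb hc, add_div, ← hagenRothe_convolution,
    Finset.mul_sum]
  refine Finset.sum_congr rfl fun p hp => ?_
  rw [Finset.HasAntidiagonal.mem_antidiagonal] at hp
  rw [glkPMF_eq_hagenRothe β ha hb hc, glkPMF_eq_hagenRothe β ha' hb hc, ← hp, pow_add,
    show a / c + a' / c + ((p.1 + p.2 : ℕ) : ℝ) * (b / c)
      = (a / c + p.1 * (b / c)) + (a' / c + p.2 * (b / c)) by push_cast; ring,
    Real.rpow_add (sub_pos.2 hβ₁) (a / c + p.1 * (b / c)) (a' / c + p.2 * (b / c))]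
  ring

/-- The generating series of the GLK distribution. -/
noncomputable def glkSeries (a b c β : ℝ) : PowerSeries ℝ≥0∞ :=
  PowerSeries.mk fun x => ENNReal.ofReal (glkPMF a b c β x)

theorem glkSeries_mul {a a' b c β : ℝ} (ha : 0 < a) (ha' : 0 < a') (hb : 0 ≤ b)
    (hc : 0 < c) (hβ₀ : 0 < β) (hβ₁ : β < 1) :
    glkSeries a b c β * glkSeries a' b c β = glkSeries (a + a') b c β := by
  ext n
  simp only [glkSeries, PowerSeries.coeff_mul, PowerSeries.coeff_mk]
  rw [← glkPMF_convolution ha ha' hb hc hβ₁, ENNReal.ofReal_sum_of_nonneg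
    fun p _ => mul_nonneg (glkPMF_nonneg ha hb hc hβ₀ hβ₁ _) (glkPMF_nonneg ha' hb hc hβ₀ hβ₁ _)]
  refine Finset.sum_congr rfl fun p _ => ?_
  rw [ENNReal.ofReal_mul (glkPMF_nonneg ha hb hc hβ₀ hβ₁ _)]

theorem glkSeries_pow {a b c β : ℝ} (ha : 0 < a) (hb : 0 ≤ b)
    (hc : 0 < c) (hβ₀ : 0 < β) (hβ₁ : β < 1) {n : ℕ} (hn : 1 ≤ n) :
    glkSeries a b c β ^ n = glkSeries (n * a) b c β := by
  induction n, hn using Nat.le_induction with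
  | base => simp
  | succ n hn ih =>
    have : (0 : ℝ) < n := by exact_mod_cast hn
    rw [pow_succ, ih, glkSeries_mul (by positivity) ha hb hc hβ₀ hβ₁]
    congr 1
    push_cast
    ring

/-! ### Power series over `[0, ∞]`: evaluation and thinning -/

/-- Regrouping by `n = i + j`. Taking `h n = s ^ n` makes evaluation multiplicative; taking `h n` to
be a coefficient of `(q + p X) ^ n` makes `thin` multiplicative. -/
theorem ENNReal.tsum_antidiagonal_mul (f g h : ℕ → ℝ≥0∞) :
    ∑' n, (∑ p ∈ Finset.HasAntidiagonal.antidiagonal n, f p.1 * g p.2) * h n =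
      ∑' i, ∑' j, f i * g j * h (i + j) := by
  have h₁ : ∀ n, (∑ p ∈ Finset.HasAntidiagonal.antidiagonal n, f p.1 * g p.2) * h n =
      ∑' p : Finset.HasAntidiagonal.antidiagonal n,
        f (p : ℕ × ℕ).1 * g (p : ℕ × ℕ).2 * h ((p : ℕ × ℕ).1 + (p : ℕ × ℕ).2) := by
    intro n
    rw [tsum_fintype, Finset.sum_mul, ← Finset.sum_coe_sort]
    refine Finset.sum_congr rfl fun p _ => ?_
    rw [Finset.HasAntidiagonal.mem_antidiagonal.1 p.2]
  simp_rw [h₁]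
  rw [← ENNReal.tsum_prod (f := fun i j => f i * g j * h (i + j)),
    ← Finset.HasAntidiagonal.sigmaAntidiagonalEquivProd.tsum_eq, ENNReal.tsum_sigma']
  rfl

namespace PowerSeries

/-- The value at `s` of a power series with coefficients in `[0, ∞]`. -/
noncomputable def ennrealEval (s : ℝ≥0∞) (f : PowerSeries ℝ≥0∞) : ℝ≥0∞ :=
  ∑' n, coeff n f * s ^ n

theorem ennrealEval_mul (s : ℝ≥0∞) (f g : PowerSeries ℝ≥0∞) :
    ennrealEval s (f * g) = ennrealEval s f * ennrealEval s g := by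
  simp only [ennrealEval, coeff_mul]
  rw [ENNReal.tsum_antidiagonal_mul (fun i => coeff i f) (fun j => coeff j g),
    ← ENNReal.tsum_mul_right]
  refine tsum_congr fun i => ?_
  rw [← ENNReal.tsum_mul_left]
  refine tsum_congr fun j => ?_
  rw [pow_add]
  ring

theorem ennrealEval_one (s : ℝ≥0∞) : ennrealEval s 1 = 1 := by
  rw [ennrealEval, tsum_eq_single 0]
  · simp
  · intro n hn
    simp [coeff_one, hn]

theorem ennrealEval_pow (s : ℝ≥0∞) (f : PowerSeries ℝ≥0∞) (n : ℕ) :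
    ennrealEval s (f ^ n) = ennrealEval s f ^ n := by
  induction n with
  | zero => simp [ennrealEval_one]
  | succ n ih => rw [pow_succ, ennrealEval_mul, ih, pow_succ]

theorem ennrealEval_zero (f : PowerSeries ℝ≥0∞) : ennrealEval 0 f = coeff 0 f := by
  rw [ennrealEval, tsum_eq_single 0]
  · simp
  · intro n hn
    simp [hn]

theorem ennrealEval_affine (p q s : ℝ≥0∞) : ennrealEval s (C q + C p * X) = q + p * s := by
  rw [ennrealEval, tsum_eq_sum (s := Finset.range 2)]
  · simp [Finset.sum_range_succ, coeff_X, coeff_C]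
  · intro n hn
    have h₀ : n ≠ 0 := by rintro rfl; simp at hn
    have h₁ : n ≠ 1 := by rintro rfl; simp at hn
    simp [coeff_X, coeff_C, h₀, h₁]

theorem coeff_le_ennrealEval_one (f : PowerSeries ℝ≥0∞) (n : ℕ) :
    coeff n f ≤ ennrealEval 1 f := by
  simpa [ennrealEval] using ENNReal.le_tsum (f := fun n => coeff n f) n

/-- Substitution of `q + p X` in a power series with coefficients in `[0, ∞]`. -/
noncomputable def thin (p q : ℝ≥0∞) (f : PowerSeries ℝ≥0∞) : PowerSeries ℝ≥0∞ :=
  mk fun k => ∑' i, coeff i f * coeff k ((C q + C p * X) ^ i)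

theorem thin_one (p q : ℝ≥0∞) : thin p q 1 = 1 := by
  ext k
  rw [thin, coeff_mk, tsum_eq_single 0]
  · simp
  · intro n hn
    simp [coeff_one, hn]

theorem thin_mul (p q : ℝ≥0∞) (f g : PowerSeries ℝ≥0∞) :
    thin p q (f * g) = thin p q f * thin p q g := by
  ext k
  simp only [thin, coeff_mk, coeff_mul (φ := f), coeff_mul k]
  rw [ENNReal.tsum_antidiagonal_mul (fun i => coeff i f) (fun j => coeff j g)]
  simp_rw [pow_add, coeff_mul, Finset.mul_sum]
  simp_rw [Summable.tsum_finsetSum (fun _ _ => ENNReal.summable)]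
  refine Finset.sum_congr rfl fun x _ => ?_
  rw [← ENNReal.tsum_mul_right]
  refine tsum_congr fun i => ?_
  rw [← ENNReal.tsum_mul_left]
  exact tsum_congr fun j => by ring

/-- `PowerSeries.thin` as a multiplicative map. -/
noncomputable def thinHom (p q : ℝ≥0∞) : PowerSeries ℝ≥0∞ →* PowerSeries ℝ≥0∞ where
  toFun := thin p q
  map_one' := thin_one p q
  map_mul' := thin_mul p q

theorem ennrealEval_thinHom (p q s : ℝ≥0∞) (f : PowerSeries ℝ≥0∞) :
    ennrealEval s (thinHom p q f) = ennrealEval (q + p * s) f := by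
  change ennrealEval s (thin p q f) = _
  simp only [ennrealEval, thin, coeff_mk, ← ENNReal.tsum_mul_right]
  rw [ENNReal.tsum_comm]
  refine tsum_congr fun i => ?_
  simp_rw [mul_assoc, ENNReal.tsum_mul_left]
  rw [← ennrealEval_affine, ← ennrealEval_pow, ennrealEval]

/-- The point `1` is fixed by `s ↦ q + p s`. -/
theorem ennrealEval_one_iterate_thinHom {p q : ℝ≥0∞} (h : q + p = 1) (m : ℕ)
    (f : PowerSeries ℝ≥0∞) : ennrealEval 1 ((thinHom p q)^[m] f) = ennrealEval 1 f := by
  induction m generalizing f with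
  | zero => rfl
  | succ m ih => rw [Function.iterate_succ_apply, ih, ennrealEval_thinHom, mul_one, h]

/-- The `m`-th iterate of `s ↦ 1 - α + α s` sends `0` to `1 - α ^ m`. -/
theorem coeff_zero_iterate_thinHom {α : ℝ} (hα₀ : 0 ≤ α) (hα₁ : α ≤ 1) (m : ℕ)
    (f : PowerSeries ℝ≥0∞) :
    coeff 0 ((thinHom (ENNReal.ofReal α) (ENNReal.ofReal (1 - α)))^[m] f) =
      ennrealEval (ENNReal.ofReal (1 - α ^ m)) f := by
  induction m generalizing f with
  | zero => simp [ennrealEval_zero]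
  | succ m ih =>
    have := pow_le_one₀ (n := m) hα₀ hα₁
    rw [Function.iterate_succ_apply, ih, ennrealEval_thinHom, ← ENNReal.ofReal_mul hα₀,
      ← ENNReal.ofReal_add (by linarith) (mul_nonneg hα₀ (by linarith))]
    congr 2
    ring

theorem coeff_affine_pow {α : ℝ} (hα₀ : 0 ≤ α) (hα₁ : α ≤ 1) (i k : ℕ) :
    coeff k ((C (ENNReal.ofReal (1 - α)) + C (ENNReal.ofReal α) * X) ^ i) =
      ENNReal.ofReal (i.choose k * α ^ k * (1 - α) ^ (i - k)) := by
  have h : ∀ m, (C (ENNReal.ofReal α) * X) ^ m * C (ENNReal.ofReal (1 - α)) ^ (i - m) *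
      ((i.choose m : ℕ) : PowerSeries ℝ≥0∞) =
      C (ENNReal.ofReal (i.choose m * α ^ m * (1 - α) ^ (i - m))) * X ^ m := by
    intro m
    rw [ENNReal.ofReal_mul (by positivity), ENNReal.ofReal_mul (by positivity),
      ENNReal.ofReal_pow hα₀, ENNReal.ofReal_pow (by linarith), ENNReal.ofReal_natCast]
    simp only [map_mul, map_pow, map_natCast]
    ring
  rw [add_comm, add_pow]
  simp_rw [h, map_sum, coeff_C_mul, coeff_X_pow]
  simp only [mul_ite, mul_one, mul_zero, Finset.sum_ite_eq, Finset.mem_range]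
  split_ifs with hk
  · rfl
  · rw [Nat.choose_eq_zero_of_lt (by omega)]
    simp

/-! ### Coefficientwise limits and extraction of an `n`-th root -/

/-- If the coefficients of two sequences of series converge to finite limits, so do those of
the products. -/
theorem tendsto_coeff_mul {ι : Type*} {l : Filter ι} {F G : ι → PowerSeries ℝ≥0∞}
    {f g : PowerSeries ℝ≥0∞} (hF : ∀ k, Tendsto (fun i => coeff k (F i)) l (𝓝 (coeff k f)))
    (hG : ∀ k, Tendsto (fun i => coeff k (G i)) l (𝓝 (coeff k g)))
    (hf : ∀ k, coeff k f ≠ ∞) (hg : ∀ k, coeff k g ≠ ∞) (k : ℕ) :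
    Tendsto (fun i => coeff k (F i * G i)) l (𝓝 (coeff k (f * g))) := by
  simp only [coeff_mul]
  exact tendsto_finsetSum _ fun p _ =>
    ENNReal.Tendsto.mul (hF _) (Or.inr (hg _)) (hG _) (Or.inr (hf _))

theorem coeff_mul_ne_top {f g : PowerSeries ℝ≥0∞} (hf : ∀ k, coeff k f ≠ ∞)
    (hg : ∀ k, coeff k g ≠ ∞) (k : ℕ) : coeff k (f * g) ≠ ∞ := by
  rw [coeff_mul]
  exact ENNReal.sum_ne_top.2 fun p _ => ENNReal.mul_ne_top (hf _) (hg _)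

theorem coeff_one_ne_top (k : ℕ) : coeff k (1 : PowerSeries ℝ≥0∞) ≠ ∞ := by
  rw [coeff_one]
  split_ifs <;> simp

theorem tendsto_coeff_pow {ι : Type*} {l : Filter ι} {F : ι → PowerSeries ℝ≥0∞}
    {f : PowerSeries ℝ≥0∞} (hF : ∀ k, Tendsto (fun i => coeff k (F i)) l (𝓝 (coeff k f)))
    (hf : ∀ k, coeff k f ≠ ∞) (n : ℕ) :
    (∀ k, coeff k (f ^ n) ≠ ∞) ∧
      ∀ k, Tendsto (fun i => coeff k (F i ^ n)) l (𝓝 (coeff k (f ^ n))) := by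
  induction n with
  | zero => simpa only [pow_zero] using ⟨coeff_one_ne_top, fun _ => tendsto_const_nhds⟩
  | succ n ih =>
    simp only [pow_succ]
    exact ⟨coeff_mul_ne_top ih.1 hf, tendsto_coeff_mul ih.2 hF ih.1 hf⟩

/-- The total mass is `1`, so any coefficient of positive index is at most `1 - coeff 0`, which
tends to `0`. -/
theorem tendsto_coeff_one_of_ennrealEval_one {ι : Type*} {l : Filter ι}
    {D : ι → PowerSeries ℝ≥0∞} (h₁ : ∀ i, ennrealEval 1 (D i) = 1)
    (h₀ : Tendsto (fun i => coeff 0 (D i)) l (𝓝 1)) (k : ℕ) :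
    Tendsto (fun i => coeff k (D i)) l (𝓝 (coeff k (1 : PowerSeries ℝ≥0∞))) := by
  rcases eq_or_ne k 0 with rfl | hk
  · simpa using h₀
  · rw [coeff_one, if_neg hk]
    have h : Tendsto (fun i => 1 - coeff 0 (D i)) l (𝓝 (1 - 1)) :=
      ENNReal.Tendsto.sub tendsto_const_nhds h₀ (Or.inl ENNReal.one_ne_top)
    rw [tsub_self] at h
    refine tendsto_of_tendsto_of_tendsto_of_le_of_le tendsto_const_nhds h (fun _ => zero_le)
      fun i => ?_
    have hfin : coeff 0 (D i) ≠ ∞ :=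
      ((coeff_le_ennrealEval_one (D i) 0).trans_lt (by simp [h₁])).ne
    refine ENNReal.le_sub_of_add_le_right hfin ?_
    rw [← h₁ i, ennrealEval]
    have := ENNReal.sum_le_tsum (f := fun n => coeff n (D i) * 1 ^ n) {k, 0}
    rwa [Finset.sum_pair hk, one_pow, one_pow, mul_one, mul_one] at this

/-- If `f` factors as `F i ^ n * D i` with `F i` and `D i` of total mass `1` and `D i → 1`
coefficientwise, then `f` is an `n`-th power. -/
theorem exists_pow_eq_of_tendsto {f : PowerSeries ℝ≥0∞} {F D : ℕ → PowerSeries ℝ≥0∞} {n : ℕ}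
    (h : ∀ i, F i ^ n * D i = f) (hF : ∀ i, ennrealEval 1 (F i) = 1)
    (hD : ∀ k, Tendsto (fun i => coeff k (D i)) atTop (𝓝 (coeff k (1 : PowerSeries ℝ≥0∞)))) :
    ∃ g, g ^ n = f := by
  -- Convergence of `F` itself is not needed: by compactness its coefficients converge along a
  -- nonprincipal ultrafilter.
  obtain ⟨x, -, hx⟩ := isCompact_univ.ultrafilter_le_nhds
    (Ultrafilter.map (fun i k => coeff k (F i)) (hyperfilter ℕ)) (by simp)
  have hx' : Tendsto (fun i k => coeff k (F i)) (hyperfilter ℕ : Filter ℕ) (𝓝 x) := hx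
  rw [tendsto_pi_nhds] at hx'
  have hle : ((hyperfilter ℕ : Ultrafilter ℕ) : Filter ℕ) ≤ atTop := by
    rw [← Nat.cofinite_eq_atTop]
    exact hyperfilter_le_cofinite
  have hlim : ∀ k, Tendsto (fun i => coeff k (F i)) (hyperfilter ℕ : Filter ℕ)
      (𝓝 (coeff k (mk x))) := by
    simpa using hx'
  -- Multiplication on `[0, ∞]` is discontinuous at `(0, ∞)`; the mass bound keeps the limits
  -- finite.
  have hfin : ∀ k, coeff k (mk x) ≠ ∞ := fun k =>
    ((le_of_tendsto' (hlim k) fun i => (coeff_le_ennrealEval_one (F i) k).trans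
      (hF i).le).trans_lt ENNReal.one_lt_top).ne
  obtain ⟨hpfin, hp⟩ := tendsto_coeff_pow hlim hfin n
  refine ⟨mk x, ?_⟩
  ext k
  have := tendsto_coeff_mul hp (fun k => (hD k).mono_left hle) hpfin coeff_one_ne_top k
  simp only [h, mul_one] at this
  exact tendsto_nhds_unique this tendsto_const_nhds

end PowerSeries

/-! ### Generating series of measures on `ℕ` -/

namespace MeasureTheory.Measure

/-- The generating series of a measure on `ℕ`. -/
noncomputable def genSeries (π : Measure ℕ) : PowerSeries ℝ≥0∞ :=
  PowerSeries.mk fun j => π {j}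

theorem ennrealEval_genSeries (π : Measure ℕ) (s : ℝ≥0∞) :
    PowerSeries.ennrealEval s π.genSeries = ∫⁻ i, s ^ i ∂π := by
  simp [PowerSeries.ennrealEval, genSeries, lintegral_countable', mul_comm]

theorem ennrealEval_one_genSeries (π : Measure ℕ) [IsProbabilityMeasure π] :
    PowerSeries.ennrealEval 1 π.genSeries = 1 := by
  simp [ennrealEval_genSeries]

theorem tendsto_ennrealEval_genSeries (π : Measure ℕ) [IsProbabilityMeasure π] {α : ℝ}
    (hα₀ : 0 ≤ α) (hα₁ : α < 1) :
    Tendsto (fun m : ℕ => PowerSeries.ennrealEval (ENNReal.ofReal (1 - α ^ m)) π.genSeries)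
      atTop (𝓝 1) := by
  simp_rw [ennrealEval_genSeries]
  have hs : Tendsto (fun m : ℕ => ENNReal.ofReal (1 - α ^ m)) atTop (𝓝 1) := by
    have := ENNReal.tendsto_ofReal
      ((tendsto_pow_atTop_nhds_zero_of_lt_one hα₀ hα₁).const_sub 1)
    simpa using this
  have := tendsto_lintegral_of_dominated_convergence (μ := π)
    (F := fun (m : ℕ) (i : ℕ) => ENNReal.ofReal (1 - α ^ m) ^ i) (f := fun _ => 1)
    (fun _ => 1) (fun _ => measurable_of_countable _) ?_ (by simp) ?_
  · simpa using this
  · refine fun m => Eventually.of_forall fun i => pow_le_one' ?_ i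
    rw [← ENNReal.ofReal_one]
    exact ENNReal.ofReal_le_ofReal (by linarith [pow_nonneg hα₀ m])
  · refine Eventually.of_forall fun i => ?_
    simpa using ENNReal.Tendsto.pow (n := i) hs

theorem coeff_genSeries_pow (ν : Measure ℕ) [IsProbabilityMeasure ν] (n j : ℕ) :
    (Measure.pi (fun _ : Fin n => ν)).map (fun y => ∑ i, y i) {j} =
      PowerSeries.coeff j (ν.genSeries ^ n) := by
  rw [Measure.map_apply (by fun_prop) (measurableSet_singleton j)]
  have hset : (fun y : Fin n → ℕ => ∑ i, y i) ⁻¹' {j} =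
      ((Finset.univ : Finset (Fin n)).piAntidiag j : Set (Fin n → ℕ)) := by
    ext y
    simp
  rw [hset, ← sum_measure_singleton]
  have hp := PowerSeries.coeff_prod (fun _ : Fin n => ν.genSeries) j Finset.univ
  rw [Finset.prod_const, Finset.card_univ, Fintype.card_fin] at hp
  rw [hp]
  simp only [genSeries, PowerSeries.coeff_mk, Measure.pi_singleton]
  refine Finset.sum_equiv Finsupp.equivFunOnFinite.symm (fun y => ?_) fun y _ => rfl
  simp

/-- The coefficients of a root `g` are already nonnegative, and its mass is `1` because its `n`-th
power is; hence they are the weights of a probability measure. -/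
theorem isInfinitelyDivisible_of_forall_exists_pow (π : Measure ℕ) [IsProbabilityMeasure π]
    (h : ∀ n : ℕ, 1 ≤ n → ∃ g, g ^ n = π.genSeries) : IsInfinitelyDivisible π := by
  intro n hn
  obtain ⟨g, hg⟩ := h n hn
  have hmass : PowerSeries.ennrealEval 1 g = 1 := by
    have := congrArg (PowerSeries.ennrealEval 1) hg
    rw [PowerSeries.ennrealEval_pow, ennrealEval_one_genSeries] at this
    exact (ENNReal.pow_right_strictMono (Nat.ne_of_gt hn)).injective (by simpa using this)
  let ν : Measure ℕ := Measure.sum fun j => PowerSeries.coeff j g • Measure.dirac j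
  have hν : ∀ j, ν {j} = PowerSeries.coeff j g := by
    intro j
    rw [Measure.sum_apply _ (measurableSet_singleton j), tsum_eq_single j]
    · simp
    · intro i hi
      simp [hi]
  have hser : ν.genSeries = g := by
    ext j
    simp [genSeries, hν]
  have hprob : IsProbabilityMeasure ν := by
    refine ⟨?_⟩
    rw [← hmass, ← hser, ennrealEval_genSeries]
    simp
  refine ⟨ν, hprob, Measure.ext_of_singleton fun j => ?_⟩
  rw [coeff_genSeries_pow, hser, hg, genSeries, PowerSeries.coeff_mk]

end MeasureTheory.Measure

/-! ### Stationary distributions of the chain -/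

theorem IsGLKStationaryDistribution.genSeries_eq {α a b c β : ℝ} {π : Measure ℕ}
    (h : IsGLKStationaryDistribution α a b c β π) (hα₀ : 0 < α) (hα₁ : α < 1)
    (ha : 0 < a) (hb : 0 ≤ b) (hc : 0 < c) (hβ₀ : 0 < β) (hβ₁ : β < 1) :
    PowerSeries.thinHom (ENNReal.ofReal α) (ENNReal.ofReal (1 - α)) π.genSeries *
      glkSeries a b c β = π.genSeries := by
  have := h.isProbabilityMeasure
  have hp := glkPMF_nonneg ha hb hc hβ₀ hβ₁
  have hα₁' : 0 ≤ 1 - α := by linarith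
  ext j
  have hterm : ∀ i, ENNReal.ofReal (glkTransition α a b c β i j * π.real {i}) =
      ∑ p ∈ Finset.HasAntidiagonal.antidiagonal j, π {i} *
        ENNReal.ofReal (i.choose p.1 * α ^ p.1 * (1 - α) ^ (i - p.1)) *
          ENNReal.ofReal (glkPMF a b c β p.2) := by
    intro i
    have hT : glkTransition α a b c β i j = ∑ p ∈ Finset.HasAntidiagonal.antidiagonal j,
        (i.choose p.1 : ℝ) * α ^ p.1 * (1 - α) ^ (i - p.1) * glkPMF a b c β p.2 := by
      rw [Finset.Nat.sum_antidiagonal_eq_sum_range_succ (fun k l =>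
        (i.choose k : ℝ) * α ^ k * (1 - α) ^ (i - k) * glkPMF a b c β l), glkTransition]
      -- The cutoff at `min i j` may be raised to `j`, since `i.choose k = 0` for `k > i`.
      refine Finset.sum_subset (by intro k; simp) fun k hk hk' => ?_
      simp only [Finset.mem_range] at hk hk'
      rw [Nat.choose_eq_zero_of_lt (by omega)]
      simp
    rw [hT, mul_comm, Finset.mul_sum, ENNReal.ofReal_sum_of_nonneg ?_]
    swap
    · intro p _
      have := hp p.2
      have : 0 ≤ π.real {i} := measureReal_nonneg
      positivity
    refine Finset.sum_congr rfl fun p _ => ?_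
    rw [ENNReal.ofReal_mul (by positivity), ENNReal.ofReal_mul (by positivity),
      ofReal_measureReal]
    simp only [mul_assoc]
  have hnn : ∀ i, 0 ≤ glkTransition α a b c β i j * π.real {i} := by
    intro i
    refine mul_nonneg (Finset.sum_nonneg fun k _ => ?_) measureReal_nonneg
    have := hp (j - k)
    positivity
  have hsum := (h.balance j)
  have e : ∑' i, ENNReal.ofReal (glkTransition α a b c β i j * π.real {i}) = π {j} := by
    rw [← ENNReal.ofReal_tsum_of_nonneg hnn hsum.summable, hsum.tsum_eq, ofReal_measureReal]
  simp_rw [hterm, Summable.tsum_finsetSum (fun _ _ => ENNReal.summable),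
    ENNReal.tsum_mul_right] at e
  rw [PowerSeries.coeff_mul]
  simp only [PowerSeries.thinHom, MonoidHom.coe_mk, OneHom.coe_mk, PowerSeries.thin,
    PowerSeries.coeff_mk, PowerSeries.coeff_affine_pow hα₀.le hα₁.le, glkSeries,
    Measure.genSeries]
  exact e

/-- A probability measure on `ℕ` that is invariant under thinning followed by the addition of an
independent GLK innovation is infinitely divisible. -/
theorem isInfinitelyDivisible_of_thinHom_mul_glkSeries {α a b c β : ℝ} {π : Measure ℕ}
    [IsProbabilityMeasure π] (hα₀ : 0 < α) (hα₁ : α < 1)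
    (ha : 0 < a) (hb : 0 ≤ b) (hc : 0 < c) (hβ₀ : 0 < β) (hβ₁ : β < 1)
    (hbal : PowerSeries.thinHom (ENNReal.ofReal α) (ENNReal.ofReal (1 - α)) π.genSeries *
      glkSeries a b c β = π.genSeries) :
    IsInfinitelyDivisible π := by
  refine Measure.isInfinitelyDivisible_of_forall_exists_pow π fun n hn => ?_
  have hn' : (0 : ℝ) < n := by exact_mod_cast hn
  set q := glkSeries (a / n) b c β
  have hq : q ^ n = glkSeries a b c β := by
    rw [glkSeries_pow (by positivity) hb hc hβ₀ hβ₁ hn, mul_div_cancel₀ _ hn'.ne']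
  set T := PowerSeries.thinHom (ENNReal.ofReal α) (ENNReal.ofReal (1 - α)) with hT
  have hαsum : ENNReal.ofReal (1 - α) + ENNReal.ofReal α = 1 := by
    rw [← ENNReal.ofReal_add (by linarith) hα₀.le]
    simp
  have hD : ∀ m, PowerSeries.ennrealEval 1 (T^[m] π.genSeries) = 1 := fun m => by
    rw [PowerSeries.ennrealEval_one_iterate_thinHom hαsum, Measure.ennrealEval_one_genSeries]
  -- Inductive step: the balance equation is inserted under `T^[m]`, which splits off one more
  -- factor `(T^[m] q) ^ n`.
  have hfac : ∀ m, (∏ k ∈ Finset.range m, T^[k] q) ^ n * T^[m] π.genSeries = π.genSeries := by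
    intro m
    induction m with
    | zero => simp
    | succ m ih =>
      nth_rw 2 [← ih]
      nth_rw 2 [← hbal]
      rw [Finset.prod_range_succ, iterate_map_mul, ← hq, iterate_map_pow,
        Function.iterate_succ_apply]
      ring
  refine PowerSeries.exists_pow_eq_of_tendsto hfac (fun m => ?_) fun k =>
    PowerSeries.tendsto_coeff_one_of_ennrealEval_one hD ?_ k
  · have := congrArg (PowerSeries.ennrealEval 1) (hfac m)
    rw [PowerSeries.ennrealEval_mul, hD, PowerSeries.ennrealEval_pow, mul_one,
      Measure.ennrealEval_one_genSeries] at this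
    exact (ENNReal.pow_right_strictMono (Nat.ne_of_gt hn)).injective (by simpa using this)
  · simp_rw [hT, PowerSeries.coeff_zero_iterate_thinHom hα₀.le hα₁.le]
    exact π.tendsto_ennrealEval_genSeries hα₀.le hα₁

/-! ### Marginals of the process -/

theorem genSeries_map_add {Ω : Type*} [MeasurableSpace Ω] {μ : Measure Ω} {U V : Ω → ℕ}
    (hU : Measurable U) (hV : Measurable V) (h : IndepFun U V μ) :
    (μ.map (fun ω => U ω + V ω)).genSeries = (μ.map U).genSeries * (μ.map V).genSeries := by
  have hUV : Measurable fun ω => U ω + V ω := hU.add hV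
  ext j
  simp only [PowerSeries.coeff_mul, Measure.genSeries, PowerSeries.coeff_mk]
  rw [Measure.map_apply hUV (measurableSet_singleton j)]
  have hset : (fun ω => U ω + V ω) ⁻¹' {j} =
      ⋃ p ∈ Finset.HasAntidiagonal.antidiagonal j, U ⁻¹' {p.1} ∩ V ⁻¹' {p.2} := by
    ext ω
    simp only [Set.mem_preimage, Set.mem_singleton_iff, Set.mem_iUnion, Set.mem_inter_iff,
      Finset.HasAntidiagonal.mem_antidiagonal, exists_prop]
    constructor
    · exact fun h => ⟨(U ω, V ω), h, rfl, rfl⟩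
    · rintro ⟨p, hp, h₁, h₂⟩
      rw [h₁, h₂, hp]
  rw [hset, measure_biUnion_finset]
  · refine Finset.sum_congr rfl fun p _ => ?_
    rw [h.measure_inter_preimage_eq_mul _ _ (measurableSet_singleton _)
      (measurableSet_singleton _), Measure.map_apply hU (measurableSet_singleton _),
      Measure.map_apply hV (measurableSet_singleton _)]
  · intro p _ q _ hpq
    rw [Function.onFun, Set.disjoint_left]
    rintro ω ⟨h₁, h₂⟩ ⟨h₃, h₄⟩
    exact hpq (Prod.ext (h₁.symm.trans h₃) (h₂.symm.trans h₄))
  · exact fun p _ => (hU (measurableSet_singleton _)).inter (hV (measurableSet_singleton _))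

theorem genSeries_map_bernoulli {Ω : Type*} [MeasurableSpace Ω] {μ : Measure Ω}
    [IsProbabilityMeasure μ] {α : ℝ} {B : Ω → ℕ} (hB : Measurable B)
    (h₁ : μ.real {ω | B ω = 1} = α) (h₀ : μ.real {ω | B ω = 0} = 1 - α) :
    (μ.map B).genSeries = PowerSeries.C (ENNReal.ofReal (1 - α)) +
      PowerSeries.C (ENNReal.ofReal α) * PowerSeries.X := by
  have hα₀ : 0 ≤ α := h₁ ▸ measureReal_nonneg
  have hα₁ : 0 ≤ 1 - α := h₀ ▸ measureReal_nonneg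
  have hprob : IsProbabilityMeasure (μ.map B) := Measure.isProbabilityMeasure_map hB.aemeasurable
  have e : ∀ k, μ.map B {k} = ENNReal.ofReal (μ.real {ω | B ω = k}) := fun k => by
    rw [Measure.map_apply hB (measurableSet_singleton k), ofReal_measureReal]
    rfl
  have e₀ := e 0
  have e₁ := e 1
  rw [h₀] at e₀
  rw [h₁] at e₁
  ext k
  match k with
  | 0 => simp [Measure.genSeries, e₀]
  | 1 => simp [Measure.genSeries, e₁, PowerSeries.coeff_C]
  -- The values `0` and `1` already carry mass `1 - α + α = 1`.
  | k + 2 =>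
    have hle : μ.map B ({0, 1} ∪ {k + 2}) ≤ 1 := prob_le_one
    rw [measure_union (by simp) (measurableSet_singleton _),
      show ({0, 1} : Set ℕ) = {0} ∪ {1} from rfl,
      measure_union (by simp) (measurableSet_singleton _), e₀, e₁,
      ← ENNReal.ofReal_add hα₁ hα₀, sub_add_cancel, ENNReal.ofReal_one] at hle
    have : μ.map B {k + 2} = 0 := by
      have := (ENNReal.add_le_add_iff_left ENNReal.one_ne_top).1 (hle.trans_eq (add_zero 1).symm)
      simpa using this
    simp [Measure.genSeries, this]

theorem genSeries_map_thinning {Ω : Type*} [MeasurableSpace Ω] {μ : Measure Ω}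
    [IsProbabilityMeasure μ] {α : ℝ} {B : ℕ → Ω → ℕ} (hB : ∀ i, Measurable (B i))
    (h₁ : ∀ i, μ.real {ω | B i ω = 1} = α) (h₀ : ∀ i, μ.real {ω | B i ω = 0} = 1 - α)
    (hind : iIndepFun B μ) (x : ℕ) :
    (μ.map (fun ω => thinning (fun i => B i ω) x)).genSeries =
      (PowerSeries.C (ENNReal.ofReal (1 - α)) +
        PowerSeries.C (ENNReal.ofReal α) * PowerSeries.X) ^ x := by
  induction x with
  | zero =>
    ext j
    rcases eq_or_ne j 0 with rfl | hj
    · simp [thinning, Measure.genSeries]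
    · simp [thinning, Measure.genSeries, PowerSeries.coeff_one, hj, hj.symm]
  | succ x ih =>
    have hmeas : Measurable fun ω => thinning (fun i => B i ω) x := by
      unfold thinning
      fun_prop
    have hi : IndepFun (fun ω => thinning (fun i => B i ω) x) (B x) μ := by
      have := hind.indepFun_finsetSum_of_notMem hB (Finset.notMem_range_self (n := x))
      convert this using 1
      ext ω
      simp [thinning]
    rw [pow_succ, ← ih, ← genSeries_map_bernoulli (hB x) (h₁ x) (h₀ x),
      ← genSeries_map_add hmeas (hB x) hi]
    simp [thinning, Finset.sum_range_succ]

/-- The marginal laws of a GLK-INAR(1) process satisfy the balance equation. -/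
theorem IsGLKINAR.genSeries_map {Ω : Type*} [MeasurableSpace Ω] {μ : Measure Ω}
    [IsProbabilityMeasure μ] {α a b c β : ℝ} {X : ℤ → Ω → ℕ} {ε : ℤ → Ω → ℕ}
    {B : ℤ → ℕ → Ω → ℕ} (h : IsGLKINAR μ α a b c β X ε B) (t : ℤ) :
    PowerSeries.thinHom (ENNReal.ofReal α) (ENNReal.ofReal (1 - α))
        (μ.map (X (t - 1))).genSeries * glkSeries a b c β = (μ.map (X t)).genSeries := by
  have hthin : ∀ i, Measurable fun u : ℕ → ℕ => thinning u i := fun i => by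
    unfold thinning
    fun_prop
  have hBm : Measurable fun ω i => B t i ω := measurable_pi_lambda _ (h.measurable_B t)
  have hT : ∀ i, Measurable fun ω => thinning (fun k => B t k ω) i :=
    fun i => (hthin i).comp hBm
  have hTε : ∀ i, Measurable fun ω => thinning (fun k => B t k ω) i + ε t ω :=
    fun i => (hT i).add (h.measurable_ε t)
  have hε : (μ.map (ε t)).genSeries = glkSeries a b c β := by
    ext k
    simp only [Measure.genSeries, glkSeries, PowerSeries.coeff_mk]
    rw [Measure.map_apply (h.measurable_ε t) (measurableSet_singleton k), ← h.law_ε t k,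
      ofReal_measureReal]
    rfl
  have hstep : ∀ i, (μ.map (fun ω => thinning (fun k => B t k ω) i + ε t ω)).genSeries =
      (PowerSeries.C (ENNReal.ofReal (1 - α)) +
        PowerSeries.C (ENNReal.ofReal α) * PowerSeries.X) ^ i * glkSeries a b c β := by
    intro i
    rw [genSeries_map_add (hT i) (h.measurable_ε t)
      ((h.indep_ε_B t).comp measurable_id (hthin i)).symm, hε,
      ← genSeries_map_thinning (h.measurable_B t) (h.law_B_one t) (h.law_B_zero t) (h.indep_B t)]
  -- On `X (t - 1) = i` the thinning has the fixed length `i`, so it depends only on `B t`, and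
  -- independence from the past factors the probability.
  have hind : ∀ i j, μ (X (t - 1) ⁻¹' {i} ∩
      (fun ω => thinning (fun k => B t k ω) i + ε t ω) ⁻¹' {j}) =
      μ.map (X (t - 1)) {i} * PowerSeries.coeff j
        (μ.map (fun ω => thinning (fun k => B t k ω) i + ε t ω)).genSeries := by
    intro i j
    have hI := (h.indep_past t).comp
      (measurable_pi_apply (⟨t - 1, by simp⟩ : Set.Iio t))
      (((hthin i).comp measurable_snd).add measurable_fst)
    rw [Measure.genSeries, PowerSeries.coeff_mk,
      Measure.map_apply (h.measurable_X _) (measurableSet_singleton _),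
      Measure.map_apply (hTε i) (measurableSet_singleton _)]
    exact hI.measure_inter_preimage_eq_mul _ _ (measurableSet_singleton i)
      (measurableSet_singleton j)
  ext j
  have hX : μ.map (X t) {j} = ∑' i, μ (X (t - 1) ⁻¹' {i} ∩
      (fun ω => thinning (fun k => B t k ω) i + ε t ω) ⁻¹' {j}) := by
    rw [Measure.map_apply (h.measurable_X t) (measurableSet_singleton j), ← measure_iUnion]
    · refine measure_congr ?_
      filter_upwards [h.recursion t] with ω hω
      change (X t ω = j) = (ω ∈ ⋃ i, _)
      simp [hω]
    · intro i i' hii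
      rw [Function.onFun, Set.disjoint_left]
      exact fun ω h₁ h₂ => hii (h₁.1.symm.trans h₂.1)
    · exact fun i => (h.measurable_X _ (measurableSet_singleton _)).inter
        ((hTε i) (measurableSet_singleton _))
  simp_rw [hind, hstep] at hX
  simp only [PowerSeries.coeff_mul, PowerSeries.thinHom, MonoidHom.coe_mk, OneHom.coe_mk,
    PowerSeries.thin, Measure.genSeries, PowerSeries.coeff_mk] at hX ⊢
  rw [hX]
  simp_rw [Finset.mul_sum, Summable.tsum_finsetSum (fun _ _ => ENNReal.summable),
    ← mul_assoc, ENNReal.tsum_mul_right]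

theorem mainTheorem3 (α a b c β : ℝ) (hα₀ : 0 < α) (hα₁ : α < 1)
    (ha : 0 < a) (hb : 0 ≤ b) (hc : 0 < c) (hβ₀ : 0 < β) (hβ₁ : β < 1) :
    (∀ π : Measure ℕ, IsGLKStationaryDistribution α a b c β π → IsInfinitelyDivisible π) ∧
    (∀ (Ω : Type*) [MeasurableSpace Ω] (μ : Measure Ω) [IsProbabilityMeasure μ]
      (X : ℤ → Ω → ℕ) (ε : ℤ → Ω → ℕ) (B : ℤ → ℕ → Ω → ℕ),
      IsGLKINAR μ α a b c β X ε B → IsStrictlyStationary μ X →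
      ∀ t : ℤ, IsInfinitelyDivisible (μ.map (X t))) := by
  refine ⟨fun π h => ?_, fun Ω _ μ _ X ε B h hs t => ?_⟩
  · have := h.isProbabilityMeasure
    exact isInfinitelyDivisible_of_thinHom_mul_glkSeries hα₀ hα₁ ha hb hc hβ₀ hβ₁
      (h.genSeries_eq hα₀ hα₁ ha hb hc hβ₀ hβ₁)
  · have : IsProbabilityMeasure (μ.map (X t)) :=
      Measure.isProbabilityMeasure_map (h.measurable_X t).aemeasurable
    -- Stationarity under the shift by `-1`, projected to the coordinate `t`.
    have hlaw : μ.map (X (t - 1)) = μ.map (X t) := by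
      have := ((hs (-1)).comp (measurable_pi_apply t)).map_eq
      exact this
    have hbal := h.genSeries_map t
    rw [hlaw] at hbal
    exact isInfinitelyDivisible_of_thinHom_mul_glkSeries hα₀ hα₁ ha hb hc hβ₀ hβ₁ hbal
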